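/- \textbf{Setting.} An agent chooses effort $a\in A=[\underline a,\bar a]$, $0\le\underline a\le\bar a$, and the state $\omega$ lies in $\Omega=[\underline\omega,\bar\omega]$, $0<\underline\omega\le\bar\omega$, with a common prior $p$ that is a Borel probability measure on $\Omega$. Output is $y(\omega,a)=\omega a^{\kappa}$ with $\kappa\in(0,1)$; the agent receives the wage $\delta y$ and the principal receives $(1-\delta)y$, where $\delta\in(0,1)$. Both have CRRA utilities of money $u(x)=\frac{x^{1-\gamma}}{1-\gamma}$ (agent) and $v(x)=\frac{x^{1-\rho}}{1-\rho}$ (principal), with $\gamma,\rho\ge 0$, $\gamma\ne1$, $\rho\ne1$, and the cost of effort is $a$. So the payoffs of the agent and of the principal are $$U(\omega,a)=\frac{(\delta\omega a^{\kappa})^{1-\gamma}}{1-\gamma}-a,\qquad V(\omega,a)=\frac{((1-\delta)\omega a^{\kappa})^{1-\rho}}{1-\rho},$$ where $U(\omega,0)=-\infty$ if $\gamma>1$. Assume that for every $\omega\in\Omega$ there is $a\in A$, $a>0$, with $U_a(\omega,a)=0$ (the agent's problem under a known state has a stationary solution in $A$). Before the state is realized, the principal commits to an information structure, that is, a Markov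 kernel from $\Omega$ to some measurable space of messages. After a message $m$ the agent chooses an effort in $A$ that maximizes $\mathbb E(U(\omega,a)\mid m)$. The principal's payoff from an information structure is the resulting expectation of $V(\omega,a)$. Full disclosure is the information structure whose message is the state itself. It is optimal if no information structure gives the principal a higher payoff, and suboptimal if some information structure gives the principal a strictly higher payoff. \textbf{Claim.} The principal's payoff from every information structure exists, is finite and is uniquely determined. Moreover: \begin{enumerate} \item If $\rho\le\gamma<1$ or $\rho\ge\gamma>1$, then full disclosure is optimal. \item If $\rho<1<\gamma$ or $\gamma<1<\rho$, and the support of $p$ contains at least two states, then full disclosure is suboptimal. \end{enumerate} -/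

import Mathlib

open MeasureTheory ProbabilityTheory

universe u

noncomputable section

namespace Persuasion

/-! ### The persuasion problem

States and actions are real numbers. The prior `p` is a probability measure on `ℝ` (concentrated on
the state space), `A` is the set of actions available to the receiver, `U ω a` and `V ω a` are the
utilities of the receiver and of the sender. An information structure is a Markov kernel `K` from
states to a measurable space `M` of messages. -/

/-- `a` maximizes the receiver's expected utility over `A` under the belief `μ`. -/
def IsBestResponse (A : Set ℝ) (U : ℝ → ℝ → ℝ) (μ : Measure ℝ) (a : ℝ) : Prop :=
  a ∈ A ∧ ∀ b ∈ A, ∫ ω, U ω b ∂μ ≤ ∫ ω, U ω a ∂μ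

/-- `σ` is a measurable action plan of the receiver that is optimal after almost every message,
where `posterior K p m` is the Bayesian posterior on states given the message `m` and
`K ∘ₘ p` is the distribution of messages. -/
structure IsOptimalPlan {M : Type*} [MeasurableSpace M] (A : Set ℝ) (U : ℝ → ℝ → ℝ)
    (p : Measure ℝ) [IsFiniteMeasure p] (K : Kernel ℝ M) [IsMarkovKernel K] (σ : M → ℝ) :
    Prop where
  measurable : Measurable σ
  optimal : ∀ᵐ m ∂(Measure.bind p K), IsBestResponse A U (posterior K p m) (σ m)

/-- `v` is the sender's (finite) expected utility from the information structure `K`, when the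
receiver best responds to every message. The measure `p ⊗ₘ K` is the joint law of the state and
the message. -/
def IsSenderPayoff {M : Type*} [MeasurableSpace M] (A : Set ℝ) (U V : ℝ → ℝ → ℝ)
    (p : Measure ℝ) [IsFiniteMeasure p] (K : Kernel ℝ M) [IsMarkovKernel K] (v : ℝ) : Prop :=
  ∃ σ : M → ℝ, IsOptimalPlan A U p K σ ∧
    Integrable (fun x : ℝ × M => V x.1 (σ x.2)) (p.compProd K) ∧
    v = ∫ x : ℝ × M, V x.1 (σ x.2) ∂(p.compProd K)

/-- Full disclosure: the message is the state itself. -/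
abbrev fullDisclosure : Kernel ℝ ℝ := Kernel.id

/-- Every information structure gives the sender one and only one expected utility. -/
def IsWellPosed (A : Set ℝ) (U V : ℝ → ℝ → ℝ) (p : Measure ℝ) [IsFiniteMeasure p] : Prop :=
  ∀ (M : Type u) [MeasurableSpace M] (K : Kernel ℝ M) [IsMarkovKernel K],
    ∃! v : ℝ, IsSenderPayoff A U V p K v

/-- No information structure gives the sender more than full disclosure. -/
def FullDisclosureOptimal (A : Set ℝ) (U V : ℝ → ℝ → ℝ) (p : Measure ℝ) [IsFiniteMeasure p] :
    Prop :=
  ∃ v₀ : ℝ, IsSenderPayoff A U V p fullDisclosure v₀ ∧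
    ∀ (M : Type u) [MeasurableSpace M] (K : Kernel ℝ M) [IsMarkovKernel K] (v : ℝ),
      IsSenderPayoff A U V p K v → v ≤ v₀

/-- Some information structure gives the sender strictly more than full disclosure. -/
def FullDisclosureSuboptimal (A : Set ℝ) (U V : ℝ → ℝ → ℝ) (p : Measure ℝ)
    [IsFiniteMeasure p] : Prop :=
  ∃ v₀ : ℝ, IsSenderPayoff A U V p fullDisclosure v₀ ∧
    ∃ (M : Type u) (_ : MeasurableSpace M) (K : Kernel ℝ M) (_ : IsMarkovKernel K) (v : ℝ),
      IsSenderPayoff A U V p K v ∧ v₀ < v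

/-! ### The principal-agent model with constant relative risk aversion -/

/-- CRRA utility of money with coefficient `γ ≠ 1`. -/
def crra (γ x : ℝ) : ℝ := x ^ (1 - γ) / (1 - γ)

/-- Output produced by effort `a` in state `ω`. -/
def output (κ ω a : ℝ) : ℝ := ω * a ^ κ

/-- Linear wage: the agent receives the share `δ` of the output. -/
def wage (δ y : ℝ) : ℝ := δ * y

/-- The agent's (receiver's) utility: utility of the wage minus the cost of effort. -/
def agentUtility (κ δ γ ω a : ℝ) : ℝ := crra γ (wage δ (output κ ω a)) - a

/-- The principal's (sender's) utility: utility of the output net of the wage. -/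
def principalUtility (κ δ ρ ω a : ℝ) : ℝ := crra ρ (output κ ω a - wage δ (output κ ω a))

/-- The effort levels in `[aLo, aHi]` at which the agent's utility is finite. If `γ > 1`, zero
effort yields zero consumption and utility `-∞`, so the agent never chooses it and it is left
out. -/
def effortSet (γ aLo aHi : ℝ) : Set ℝ := {a | a ∈ Set.Icc aLo aHi ∧ (1 < γ → a ≠ 0)}

end Persuasion

end

namespace Persuasion

/-! ### Inequalities for real powers -/

/-! The agent's utility is affine in X = ω ^ (1 - γ), so a belief matters only through the mean x of
X, and the unique best effort is a power of x (`isBestResponse_iff`). Hence the principal's utility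
is the monomial c * X ^ t * x ^ s with t = (1 - ρ) / (1 - γ), s = `effortExponent κ γ ρ` and c =
`payoffScale κ δ γ ρ / (1 - ρ)`; under full disclosure x = X and it is c * X ^ (t + s).

Given the message, X - x has mean zero, so any function of the message times X - x can be subtracted
from the difference of the two utilities without changing its expectation. The choice that removes
the first-order term at X = x leaves c * `powerGap t s X x`, so the advantage of full disclosure is
the expectation of this quantity (`integral_fullDisclosure_sub`).

Its sign is settled pointwise: homogeneity reduces it to one variable, where Bernoulli's inequality
applies. It is nonnegative in the first pair of cases (`mul_powerGap_nonneg`). In the second pair it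
is negative unless X = x (`mul_powerGap_neg`), so that no disclosure already beats full disclosure.
-/

/-- Strict Bernoulli inequality for negative exponents. -/
lemma one_add_mul_sub_lt_rpow_of_neg {x θ : ℝ} (hx : 0 < x) (hx1 : x ≠ 1) (hθ : θ < 0) :
    1 + θ * (x - 1) < x ^ θ := by
  have h1 : Real.log x < x - 1 := Real.log_lt_sub_one_of_pos hx hx1
  have h2 : θ * Real.log x + 1 ≤ x ^ θ := by
    rw [Real.rpow_def_of_pos hx, mul_comm θ]
    exact Real.add_one_le_exp _
  nlinarith

/-- Bernoulli inequality for exponents in `[0, 1]`, centred at `1`. -/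
lemma rpow_le_one_add_mul_sub {x θ : ℝ} (hx : 0 ≤ x) (hθ₀ : 0 ≤ θ) (hθ₁ : θ ≤ 1) :
    x ^ θ ≤ 1 + θ * (x - 1) := by
  simpa using rpow_one_add_le_one_add_mul_self (s := x - 1) (by linarith) hθ₀ hθ₁

/-- The function `x ↦ x ^ θ / θ - x` has its only maximum at `1` if `θ < 1`, `θ ≠ 0`. -/
lemma rpow_div_sub_self_lt {x θ : ℝ} (hx : 0 ≤ x) (hx0 : θ < 0 → x ≠ 0) (hx1 : x ≠ 1)
    (hθ₀ : θ ≠ 0) (hθ₁ : θ < 1) : x ^ θ / θ - x < 1 / θ - 1 := by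
  rcases lt_or_gt_of_ne hθ₀ with hθ | hθ
  · have h := one_add_mul_sub_lt_rpow_of_neg (lt_of_le_of_ne hx (hx0 hθ).symm) hx1 hθ
    have h' : x ^ θ / θ < (1 + θ * (x - 1)) / θ := (div_lt_div_right_of_neg hθ).2 h
    have e : (1 + θ * (x - 1)) / θ = 1 / θ + (x - 1) := by field_simp
    linarith
  · have h : x ^ θ < 1 + θ * (x - 1) := by
      simpa using rpow_one_add_lt_one_add_mul_self (s := x - 1) (by linarith)
        (sub_ne_zero.2 hx1) hθ hθ₁
    have h' : x ^ θ / θ < (1 + θ * (x - 1)) / θ := (div_lt_div_iff_of_pos_right hθ).2 h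
    have e : (1 + θ * (x - 1)) / θ = 1 / θ + (x - 1) := by field_simp
    linarith

/-- In the variable y = x ^ (t + s), both x ^ t and x are concave powers of y, hence lie below their
tangents at y = 1. The slopes, weighted by 1 and s, add up to 1. -/
lemma rpow_add_mul_le_rpow_add {x t s : ℝ} (hx : 0 < x) (ht : 0 ≤ t) (hs : 0 < s)
    (hts : 1 ≤ t + s) : x ^ t + s * x ≤ x ^ (t + s) + s := by
  have hpos : 0 < t + s := by linarith
  have hy : 0 ≤ x ^ (t + s) := (Real.rpow_pos_of_pos hx _).le
  have h1 := rpow_le_one_add_mul_sub hy (θ := t / (t + s)) (by positivity)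
    ((div_le_one hpos).2 (by linarith))
  have h2 := rpow_le_one_add_mul_sub hy (θ := 1 / (t + s)) (by positivity)
    ((div_le_one hpos).2 hts)
  rw [← Real.rpow_mul hx.le, mul_div_cancel₀ _ hpos.ne'] at h1
  rw [← Real.rpow_mul hx.le, mul_div_cancel₀ _ hpos.ne', Real.rpow_one] at h2
  have h3 : t / (t + s) + s * (1 / (t + s)) = 1 := by field_simp
  calc x ^ t + s * x ≤ (1 + t / (t + s) * (x ^ (t + s) - 1))
        + s * (1 + 1 / (t + s) * (x ^ (t + s) - 1)) := by gcongr
    _ = 1 + s + (t / (t + s) + s * (1 / (t + s))) * (x ^ (t + s) - 1) := by ring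
    _ = x ^ (t + s) + s := by rw [h3]; ring

/-- In the variable y = x ^ t the left power has exponent (t + s) / t in [0, 1], so it lies below
its tangent at y = 1. Strictness comes from the Bernoulli bound on y itself, multiplied by s / t <
0. -/
lemma rpow_add_add_lt_rpow_add_mul {x t s : ℝ} (hx : 0 < x) (hx1 : x ≠ 1) (hs : 0 < s)
    (hts : t + s < 0) : x ^ (t + s) + s < x ^ t + s * x := by
  have ht : t < 0 := by linarith
  have h1 := rpow_le_one_add_mul_sub (Real.rpow_pos_of_pos hx t).le (θ := (t + s) / t)
    (div_nonneg_of_nonpos hts.le ht.le) ((div_le_one_of_neg ht).2 (by linarith))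
  rw [← Real.rpow_mul hx.le, mul_div_cancel₀ _ ht.ne] at h1
  have h2 := one_add_mul_sub_lt_rpow_of_neg hx hx1 ht
  have h3 : s / t * (x ^ t - 1) < s / t * (t * (x - 1)) :=
    mul_lt_mul_of_neg_left (by linarith) (div_neg_of_pos_of_neg hs ht)
  have h4 : s / t * (t * (x - 1)) = s * (x - 1) := by
    rw [← mul_assoc, div_mul_cancel₀ _ ht.ne]
  have h5 : (t + s) / t = 1 + s / t := by rw [add_div, div_self ht.ne]
  rw [h5] at h1
  linarith

/-- The gap between `x ^ (t + s)` and `x ^ t * b ^ s`, corrected by a multiple of `x - b` that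
makes it vanish to first order at `x = b`. -/
noncomputable def powerGap (t s x b : ℝ) : ℝ :=
  x ^ (t + s) - x ^ t * b ^ s - s * b ^ (t + s - 1) * (x - b)

/-- The gap is homogeneous of degree t + s in (x, b), so only the ratio x / b matters for its sign.
-/
lemma powerGap_eq_mul {t s x b : ℝ} (hx : 0 < x) (hb : 0 < b) :
    powerGap t s x b =
      b ^ (t + s) * ((x / b) ^ (t + s) - (x / b) ^ t - s * (x / b - 1)) := by
  have hbt := Real.rpow_pos_of_pos hb t
  have hbs := Real.rpow_pos_of_pos hb s
  rw [powerGap, Real.div_rpow hx.le hb.le, Real.div_rpow hx.le hb.le, Real.rpow_sub_one hb.ne',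
    Real.rpow_add hb]
  field_simp

lemma powerGap_nonneg {t s x b : ℝ} (hx : 0 < x) (hb : 0 < b) (ht : 1 ≤ t) (hs : 0 < s) :
    0 ≤ powerGap t s x b := by
  rw [powerGap_eq_mul hx hb]
  refine mul_nonneg (Real.rpow_pos_of_pos hb _).le ?_
  have := rpow_add_mul_le_rpow_add (div_pos hx hb) (t := t) (by linarith) hs (by linarith)
  linarith

lemma powerGap_nonpos {t s x b : ℝ} (hx : 0 < x) (hb : 0 < b) (ht : 1 ≤ t) (hs : s < 0)
    (hts : 0 ≤ t + s) : powerGap t s x b ≤ 0 := by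
  rw [powerGap_eq_mul hx hb]
  refine mul_nonpos_of_nonneg_of_nonpos (Real.rpow_pos_of_pos hb _).le ?_
  -- Replacing (t, s) by (t + s, -s) exchanges the two powers and so reverses the sign of the gap.
  have := rpow_add_mul_le_rpow_add (div_pos hx hb) (t := t + s) (s := -s) hts (by linarith)
    (by linarith)
  rw [add_neg_cancel_right] at this
  linarith

lemma powerGap_neg {t s x b : ℝ} (hx : 0 < x) (hb : 0 < b) (hxb : x ≠ b) (hs : 0 < s)
    (hts : t + s < 0) : powerGap t s x b < 0 := by
  rw [powerGap_eq_mul hx hb]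
  refine mul_neg_of_pos_of_neg (Real.rpow_pos_of_pos hb _) ?_
  have := rpow_add_add_lt_rpow_add_mul (div_pos hx hb) (by rwa [ne_eq, div_eq_one_iff_eq hb.ne'])
    hs hts
  linarith

lemma powerGap_pos {t s x b : ℝ} (hx : 0 < x) (hb : 0 < b) (hxb : x ≠ b) (ht : t < 0)
    (hs : s < 0) : 0 < powerGap t s x b := by
  rw [powerGap_eq_mul hx hb]
  refine mul_pos (Real.rpow_pos_of_pos hb _) ?_
  have := rpow_add_add_lt_rpow_add_mul (t := t + s) (s := -s) (div_pos hx hb)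
    (by rwa [ne_eq, div_eq_one_iff_eq hb.ne']) (by linarith) (by linarith)
  rw [add_neg_cancel_right] at this
  linarith

lemma powerGap_self {t s b : ℝ} (hb : 0 < b) : powerGap t s b b = 0 := by
  rw [powerGap, Real.rpow_add hb]; ring

/-! ### The agent's problem -/

/-- The agent's optimal effort under a belief for which `ω ^ (1 - γ)` has expectation `x`. -/
noncomputable def optEffort (κ δ γ x : ℝ) : ℝ :=
  (κ * δ ^ (1 - γ) * x) ^ (1 - κ * (1 - γ))⁻¹

lemma optEffort_pos {κ δ γ x : ℝ} (hκ : 0 < κ) (hδ : 0 < δ) (hx : 0 < x) :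
    0 < optEffort κ δ γ x := by
  unfold optEffort
  positivity

lemma one_sub_mul_pos {κ γ : ℝ} (hκ₀ : 0 < κ) (hκ₁ : κ < 1) (hγ : 0 ≤ γ) :
    0 < 1 - κ * (1 - γ) := by
  nlinarith [mul_nonneg hκ₀.le hγ]

lemma optEffort_rpow {κ δ γ x : ℝ} (hκ₀ : 0 < κ) (hκ₁ : κ < 1) (hδ : 0 < δ) (hγ : 0 ≤ γ)
    (hx : 0 < x) :
    optEffort κ δ γ x ^ (1 - κ * (1 - γ)) = κ * δ ^ (1 - γ) * x := by
  rw [optEffort, ← Real.rpow_mul (by positivity),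
    inv_mul_cancel₀ (one_sub_mul_pos hκ₀ hκ₁ hγ).ne', Real.rpow_one]

lemma optEffort_le_optEffort {κ δ γ x y : ℝ} (hκ₀ : 0 < κ) (hκ₁ : κ < 1) (hδ : 0 < δ)
    (hγ : 0 ≤ γ) (hx : 0 < x) (hxy : x ≤ y) : optEffort κ δ γ x ≤ optEffort κ δ γ y := by
  have := one_sub_mul_pos hκ₀ hκ₁ hγ
  unfold optEffort
  gcongr

lemma agentUtility_eq {κ δ γ ω a : ℝ} (hδ : 0 < δ) (hω : 0 < ω) (ha : 0 ≤ a) :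
    agentUtility κ δ γ ω a =
      ω ^ (1 - γ) * (δ ^ (1 - γ) * a ^ (κ * (1 - γ)) / (1 - γ)) - a := by
  have h : 0 ≤ a ^ κ := Real.rpow_nonneg ha κ
  rw [agentUtility, crra, wage, output, Real.mul_rpow hδ.le (by positivity),
    Real.mul_rpow hω.le h, ← Real.rpow_mul ha]
  ring

/-- Expected utility is maximized at `optEffort`, and only there. -/
lemma mul_rpow_sub_lt_optEffort {κ δ γ x b : ℝ} (hκ₀ : 0 < κ) (hκ₁ : κ < 1) (hδ : 0 < δ)
    (hγ : 0 ≤ γ) (hγ₁ : γ ≠ 1) (hx : 0 < x) (hb : 0 ≤ b) (hb0 : 1 < γ → b ≠ 0)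
    (hne : b ≠ optEffort κ δ γ x) :
    x * (δ ^ (1 - γ) * b ^ (κ * (1 - γ)) / (1 - γ)) - b <
      x * (δ ^ (1 - γ) * optEffort κ δ γ x ^ (κ * (1 - γ)) / (1 - γ)) - optEffort κ δ γ x := by
  have hg : 1 - γ ≠ 0 := sub_ne_zero.2 hγ₁.symm
  have hA := optEffort_pos (γ := γ) hκ₀ hδ hx
  have hrp := optEffort_rpow hκ₀ hκ₁ hδ hγ hx
  set A := optEffort κ δ γ x
  have hAθ : 0 < A ^ (κ * (1 - γ)) := Real.rpow_pos_of_pos hA _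
  -- With θ = κ * (1 - γ), the first-order condition gives κ * δ ^ (1 - γ) * x = A / A ^ θ. The
  -- objective is then A times r ^ θ / θ - r at r = b / A, whose only maximum is at r = 1.
  rw [Real.rpow_sub hA, Real.rpow_one] at hrp
  have key := rpow_div_sub_self_lt (x := b / A) (θ := κ * (1 - γ)) (by positivity)
    (fun h => div_ne_zero (hb0 (by nlinarith)) hA.ne')
    (by rwa [ne_eq, div_eq_one_iff_eq hA.ne']) (mul_ne_zero hκ₀.ne' hg)
    (by linarith [one_sub_mul_pos hκ₀ hκ₁ hγ])
  rw [Real.div_rpow hb hA.le] at key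
  have hmul := mul_lt_mul_of_pos_left key hA
  have e : ∀ z : ℝ, x * (δ ^ (1 - γ) * z / (1 - γ)) =
      A / A ^ (κ * (1 - γ)) * z / (κ * (1 - γ)) := by
    intro z
    rw [hrp]
    field_simp
  rw [e, e]
  have e1 : A * (b ^ (κ * (1 - γ)) / A ^ (κ * (1 - γ)) / (κ * (1 - γ)) - b / A) =
      A / A ^ (κ * (1 - γ)) * b ^ (κ * (1 - γ)) / (κ * (1 - γ)) - b := by field_simp
  have e2 : A * (1 / (κ * (1 - γ)) - 1) =
      A / A ^ (κ * (1 - γ)) * A ^ (κ * (1 - γ)) / (κ * (1 - γ)) - A := by field_simp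
  rw [← e1, ← e2]
  exact hmul

/-- A stationary effort of the agent who knows the state is the optimal one. -/
lemma eq_optEffort_of_hasDerivAt {κ δ γ ω a : ℝ} (hκ₀ : 0 < κ) (hκ₁ : κ < 1) (hδ : 0 < δ)
    (hγ : 0 ≤ γ) (hγ₁ : γ ≠ 1) (hω : 0 < ω) (ha : 0 < a)
    (h : HasDerivAt (agentUtility κ δ γ ω) 0 a) : a = optEffort κ δ γ (ω ^ (1 - γ)) := by
  have hg : 1 - γ ≠ 0 := sub_ne_zero.2 hγ₁.symm
  have hd : HasDerivAt
      (fun a => ω ^ (1 - γ) * (δ ^ (1 - γ) * a ^ (κ * (1 - γ)) / (1 - γ)) - a)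
      (ω ^ (1 - γ) * (δ ^ (1 - γ) * ((κ * (1 - γ)) * a ^ (κ * (1 - γ) - 1)) / (1 - γ)) - 1) a :=
    (((((Real.hasDerivAt_rpow_const (Or.inl ha.ne')).const_mul _).div_const _).const_mul _).sub
      (hasDerivAt_id a))
  -- The separated form is available only for nonnegative effort; a neighbourhood of a > 0 suffices
  -- for the derivative.
  have heq : agentUtility κ δ γ ω =ᶠ[nhds a]
      fun a => ω ^ (1 - γ) * (δ ^ (1 - γ) * a ^ (κ * (1 - γ)) / (1 - γ)) - a := by
    filter_upwards [lt_mem_nhds ha] with b hb using agentUtility_eq hδ hω hb.le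
  have h0 := (h.congr_of_eventuallyEq heq.symm).unique hd
  have h1 : κ * δ ^ (1 - γ) * ω ^ (1 - γ) * a ^ (κ * (1 - γ) - 1) = 1 := by
    have : ω ^ (1 - γ) * (δ ^ (1 - γ) * ((κ * (1 - γ)) * a ^ (κ * (1 - γ) - 1)) / (1 - γ)) =
        κ * δ ^ (1 - γ) * ω ^ (1 - γ) * a ^ (κ * (1 - γ) - 1) := by field_simp
    linarith
  have h2 : κ * δ ^ (1 - γ) * ω ^ (1 - γ) = a ^ (1 - κ * (1 - γ)) := by
    have hn : κ * (1 - γ) - 1 = -(1 - κ * (1 - γ)) := by ring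
    rw [hn, Real.rpow_neg ha.le] at h1
    exact eq_of_mul_inv_eq_one h1
  rw [optEffort, h2, ← Real.rpow_mul ha.le,
    mul_inv_cancel₀ (one_sub_mul_pos hκ₀ hκ₁ hγ).ne', Real.rpow_one]

/-! ### The principal's utility from optimal effort -/

/-- The exponent with which `E (ω ^ (1 - γ))` enters the principal's utility. -/
noncomputable def effortExponent (κ γ ρ : ℝ) : ℝ := κ * (1 - ρ) / (1 - κ * (1 - γ))

/-- The scale of the principal's utility from optimal effort. -/
noncomputable def payoffScale (κ δ γ ρ : ℝ) : ℝ :=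
  (1 - δ) ^ (1 - ρ) * (κ * δ ^ (1 - γ)) ^ effortExponent κ γ ρ

lemma payoffScale_pos {κ δ γ ρ : ℝ} (hκ : 0 < κ) (hδ₀ : 0 < δ) (hδ₁ : δ < 1) :
    0 < payoffScale κ δ γ ρ := by
  have : 0 < 1 - δ := by linarith
  unfold payoffScale
  positivity

/-- The factor ω ^ (1 - ρ) is written as a power of ω ^ (1 - γ), so that the state and the belief
enter through the same statistic. -/
lemma principalUtility_optEffort {κ δ γ ρ ω x : ℝ} (hκ₀ : 0 < κ) (hδ₀ : 0 < δ) (hδ₁ : δ < 1)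
    (hγ₁ : γ ≠ 1) (hω : 0 < ω) (hx : 0 < x) :
    principalUtility κ δ ρ ω (optEffort κ δ γ x) =
      payoffScale κ δ γ ρ / (1 - ρ) *
        ((ω ^ (1 - γ)) ^ ((1 - ρ) / (1 - γ)) * x ^ effortExponent κ γ ρ) := by
  have hg : 1 - γ ≠ 0 := sub_ne_zero.2 hγ₁.symm
  have h1δ : 0 < 1 - δ := by linarith
  have hA := optEffort_pos (γ := γ) hκ₀ hδ₀ hx
  have e : ω * optEffort κ δ γ x ^ κ - δ * (ω * optEffort κ δ γ x ^ κ) =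
      (1 - δ) * (ω * optEffort κ δ γ x ^ κ) := by ring
  have e2 : (optEffort κ δ γ x ^ κ) ^ (1 - ρ) =
      (κ * δ ^ (1 - γ)) ^ effortExponent κ γ ρ * x ^ effortExponent κ γ ρ := by
    rw [← Real.rpow_mul hA.le, optEffort, ← Real.rpow_mul (by positivity),
      ← Real.mul_rpow (by positivity) hx.le, effortExponent]
    congr 1
    rw [div_eq_mul_inv, mul_comm]
  rw [principalUtility, crra, wage, output, e, Real.mul_rpow h1δ.le (by positivity),
    Real.mul_rpow hω.le (by positivity), e2, ← Real.rpow_mul hω.le, mul_div_cancel₀ _ hg,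
    payoffScale]
  ring

/-- The loss of the principal when the agent acts on the expectation `x` of `ω ^ (1 - γ)` rather
than on the state, corrected by the agent's first-order condition. -/
lemma principalUtility_sub_eq {κ δ γ ρ ω x : ℝ} (hκ₀ : 0 < κ) (hδ₀ : 0 < δ) (hδ₁ : δ < 1)
    (hγ₁ : γ ≠ 1) (hω : 0 < ω) (hx : 0 < x) :
    principalUtility κ δ ρ ω (optEffort κ δ γ (ω ^ (1 - γ))) -
        principalUtility κ δ ρ ω (optEffort κ δ γ x) =
      payoffScale κ δ γ ρ / (1 - ρ) *
          powerGap ((1 - ρ) / (1 - γ)) (effortExponent κ γ ρ) (ω ^ (1 - γ)) x +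
        payoffScale κ δ γ ρ / (1 - ρ) * (effortExponent κ γ ρ *
          x ^ ((1 - ρ) / (1 - γ) + effortExponent κ γ ρ - 1)) * (ω ^ (1 - γ) - x) := by
  have hX : 0 < ω ^ (1 - γ) := Real.rpow_pos_of_pos hω _
  rw [principalUtility_optEffort hκ₀ hδ₀ hδ₁ hγ₁ hω hx,
    principalUtility_optEffort hκ₀ hδ₀ hδ₁ hγ₁ hω hX, powerGap, Real.rpow_add hX]
  ring

/-- When 1 - κ * (1 - γ) is positive, this shows that t + s has the sign of t. -/
lemma div_add_effortExponent {κ γ ρ : ℝ} (hg : 1 - γ ≠ 0) (hden : 1 - κ * (1 - γ) ≠ 0) :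
    (1 - ρ) / (1 - γ) + effortExponent κ γ ρ = (1 - ρ) / (1 - γ) / (1 - κ * (1 - γ)) := by
  rw [effortExponent, div_div, div_add_div _ _ hg hden]
  congr 1
  ring

/-- Both cases have t ≥ 1. For γ < 1 the prefactor and s are positive; for γ > 1 both are negative,
and t + s ≥ 0. -/
lemma mul_powerGap_nonneg {κ δ γ ρ x b : ℝ} (hκ₀ : 0 < κ) (hκ₁ : κ < 1) (hδ₀ : 0 < δ)
    (hδ₁ : δ < 1) (hγ : 0 ≤ γ) (h : (ρ ≤ γ ∧ γ < 1) ∨ (γ ≤ ρ ∧ 1 < γ)) (hx : 0 < x)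
    (hb : 0 < b) :
    0 ≤ payoffScale κ δ γ ρ / (1 - ρ) *
      powerGap ((1 - ρ) / (1 - γ)) (effortExponent κ γ ρ) x b := by
  have hC := payoffScale_pos (γ := γ) (ρ := ρ) hκ₀ hδ₀ hδ₁
  have hden := one_sub_mul_pos hκ₀ hκ₁ hγ
  rcases h with ⟨h1, h2⟩ | ⟨h1, h2⟩
  · have hr : 0 < 1 - ρ := by linarith
    refine mul_nonneg (by positivity) (powerGap_nonneg hx hb ?_ ?_)
    · rw [one_le_div (by linarith)]; linarith
    · unfold effortExponent; positivity
  · have hr : 1 - ρ < 0 := by linarith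
    have hg : 1 - γ < 0 := by linarith
    refine mul_nonneg_of_nonpos_of_nonpos (div_nonpos_of_nonneg_of_nonpos hC.le hr.le)
      (powerGap_nonpos hx hb ?_ ?_ ?_)
    · rw [one_le_div_of_neg hg]; linarith
    · exact div_neg_of_neg_of_pos (mul_neg_of_pos_of_neg hκ₀ hr) hden
    · rw [div_add_effortExponent hg.ne hden.ne']
      exact div_nonneg (div_nonneg_of_nonpos hr.le hg.le) hden.le

/-- Both cases have t < 0 and t + s < 0; the prefactor and s share the sign of 1 - ρ, which is
opposite to that of the gap. -/
lemma mul_powerGap_neg {κ δ γ ρ x b : ℝ} (hκ₀ : 0 < κ) (hκ₁ : κ < 1) (hδ₀ : 0 < δ)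
    (hδ₁ : δ < 1) (hγ : 0 ≤ γ) (h : (ρ < 1 ∧ 1 < γ) ∨ (γ < 1 ∧ 1 < ρ)) (hx : 0 < x)
    (hb : 0 < b) (hxb : x ≠ b) :
    payoffScale κ δ γ ρ / (1 - ρ) *
      powerGap ((1 - ρ) / (1 - γ)) (effortExponent κ γ ρ) x b < 0 := by
  have hC := payoffScale_pos (γ := γ) (ρ := ρ) hκ₀ hδ₀ hδ₁
  have hden := one_sub_mul_pos hκ₀ hκ₁ hγ
  rcases h with ⟨h1, h2⟩ | ⟨h1, h2⟩
  · have hr : 0 < 1 - ρ := by linarith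
    have hg : 1 - γ < 0 := by linarith
    refine mul_neg_of_pos_of_neg (by positivity) (powerGap_neg hx hb hxb ?_ ?_)
    · unfold effortExponent; positivity
    · rw [div_add_effortExponent hg.ne hden.ne']
      exact div_neg_of_neg_of_pos (div_neg_of_pos_of_neg hr hg) hden
  · have hr : 1 - ρ < 0 := by linarith
    have hg : 0 < 1 - γ := by linarith
    refine mul_neg_of_neg_of_pos (div_neg_of_pos_of_neg hC hr) (powerGap_pos hx hb hxb ?_ ?_)
    · exact div_neg_of_neg_of_pos hr hg
    · exact div_neg_of_neg_of_pos (mul_neg_of_pos_of_neg hκ₀ hr) hden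

end Persuasion

namespace Persuasion

/-! ### Best responses -/

/-- The unordered interval treats increasing and decreasing powers (γ < 1 and γ > 1) together. -/
lemma rpow_mem_uIcc {lo hi ω g : ℝ} (hlo : 0 < lo) (hω : ω ∈ Set.Icc lo hi) :
    ω ^ g ∈ Set.uIcc (lo ^ g) (hi ^ g) := by
  have hω0 : 0 < ω := hlo.trans_le hω.1
  rcases le_total 0 g with hg | hg
  · exact Set.mem_uIcc_of_le (Real.rpow_le_rpow hlo.le hω.1 hg) (Real.rpow_le_rpow hω0.le hω.2 hg)
  · exact Set.mem_uIcc_of_ge (Real.rpow_le_rpow_of_nonpos hω0 hω.2 hg)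
      (Real.rpow_le_rpow_of_nonpos hlo hω.1 hg)

lemma pos_of_mem_uIcc_rpow {lo hi x g : ℝ} (hlo : 0 < lo) (hhi : 0 < hi)
    (hx : x ∈ Set.uIcc (lo ^ g) (hi ^ g)) : 0 < x :=
  (lt_min (Real.rpow_pos_of_pos hlo g) (Real.rpow_pos_of_pos hhi g)).trans_le hx.1

lemma integrable_rpow_of_ae_mem {lo hi : ℝ} (hlo : 0 < lo) {μ : Measure ℝ} [IsFiniteMeasure μ]
    (hμ : ∀ᵐ ω ∂μ, ω ∈ Set.Icc lo hi) (g : ℝ) : Integrable (fun ω => ω ^ g) μ := by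
  obtain ⟨C, hC⟩ := (isCompact_uIcc (a := lo ^ g) (b := hi ^ g)).isBounded.exists_norm_le
  refine Integrable.of_bound (by fun_prop) C ?_
  filter_upwards [hμ] with ω hω using hC _ (rpow_mem_uIcc hlo hω)

lemma integral_rpow_mem_uIcc {lo hi : ℝ} (hlo : 0 < lo) {μ : Measure ℝ} [IsProbabilityMeasure μ]
    (hμ : ∀ᵐ ω ∂μ, ω ∈ Set.Icc lo hi) (g : ℝ) :
    ∫ ω, ω ^ g ∂μ ∈ Set.uIcc (lo ^ g) (hi ^ g) :=
  (convex_uIcc _ _).integral_mem isClosed_Icc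
    (hμ.mono fun _ hω => rpow_mem_uIcc hlo hω) (integrable_rpow_of_ae_mem hlo hμ g)

/-- Under the stationarity assumption the optimal effort is always available. -/
lemma optEffort_mem_effortSet {κ δ γ : ℝ} (hκ₀ : 0 < κ) (hκ₁ : κ < 1) (hδ : 0 < δ)
    (hγ : 0 ≤ γ) (hγ₁ : γ ≠ 1) {lo hi aLo aHi : ℝ} (hlo : 0 < lo) (hlohi : lo ≤ hi)
    (hint : ∀ ω ∈ Set.Icc lo hi, ∃ a ∈ Set.Icc aLo aHi,
      0 < a ∧ HasDerivAt (agentUtility κ δ γ ω) 0 a)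
    {x : ℝ} (hx : x ∈ Set.uIcc (lo ^ (1 - γ)) (hi ^ (1 - γ))) :
    optEffort κ δ γ x ∈ effortSet γ aLo aHi := by
  have hhi : 0 < hi := hlo.trans_le hlohi
  have hx0 := pos_of_mem_uIcc_rpow hlo hhi hx
  have hmem : ∀ ω ∈ Set.Icc lo hi, optEffort κ δ γ (ω ^ (1 - γ)) ∈ Set.Icc aLo aHi := by
    intro ω hω
    obtain ⟨a, ha, ha0, hd⟩ := hint ω hω
    rwa [← eq_optEffort_of_hasDerivAt hκ₀ hκ₁ hδ hγ hγ₁ (hlo.trans_le hω.1) ha0 hd]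
  -- Optimal effort is monotone in x, so feasibility at the two extreme states implies it in
  -- between.
  have h1 := hmem lo ⟨le_rfl, hlohi⟩
  have h2 := hmem hi ⟨hlohi, le_rfl⟩
  refine ⟨?_, fun _ => (optEffort_pos hκ₀ hδ hx0).ne'⟩
  rcases Set.mem_uIcc.1 hx with ⟨ha, hb⟩ | ⟨ha, hb⟩
  · exact ⟨h1.1.trans (optEffort_le_optEffort hκ₀ hκ₁ hδ hγ (by positivity) ha),
      (optEffort_le_optEffort hκ₀ hκ₁ hδ hγ hx0 hb).trans h2.2⟩
  · exact ⟨h2.1.trans (optEffort_le_optEffort hκ₀ hκ₁ hδ hγ (by positivity) ha),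
      (optEffort_le_optEffort hκ₀ hκ₁ hδ hγ hx0 hb).trans h1.2⟩

lemma integral_agentUtility {κ δ γ lo hi a : ℝ} (hδ : 0 < δ) (hlo : 0 < lo) {μ : Measure ℝ}
    [IsProbabilityMeasure μ] (hμ : ∀ᵐ ω ∂μ, ω ∈ Set.Icc lo hi) (ha : 0 ≤ a) :
    ∫ ω, agentUtility κ δ γ ω a ∂μ =
      (∫ ω, ω ^ (1 - γ) ∂μ) * (δ ^ (1 - γ) * a ^ (κ * (1 - γ)) / (1 - γ)) - a := by
  have h : ∀ᵐ ω ∂μ, agentUtility κ δ γ ω a =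
      ω ^ (1 - γ) * (δ ^ (1 - γ) * a ^ (κ * (1 - γ)) / (1 - γ)) - a :=
    hμ.mono fun ω hω => agentUtility_eq hδ (hlo.trans_le hω.1) ha
  rw [integral_congr_ae h, integral_sub ((integrable_rpow_of_ae_mem hlo hμ _).mul_const _)
    (integrable_const _), integral_mul_const]
  simp

lemma isBestResponse_iff {κ δ γ : ℝ} (hκ₀ : 0 < κ) (hκ₁ : κ < 1) (hδ : 0 < δ)
    (hγ : 0 ≤ γ) (hγ₁ : γ ≠ 1) {lo hi aLo aHi : ℝ} (hlo : 0 < lo) (hlohi : lo ≤ hi)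
    (hA : 0 ≤ aLo)
    (hint : ∀ ω ∈ Set.Icc lo hi, ∃ a ∈ Set.Icc aLo aHi,
      0 < a ∧ HasDerivAt (agentUtility κ δ γ ω) 0 a)
    {μ : Measure ℝ} [IsProbabilityMeasure μ] (hμ : ∀ᵐ ω ∂μ, ω ∈ Set.Icc lo hi) (a : ℝ) :
    IsBestResponse (effortSet γ aLo aHi) (agentUtility κ δ γ) μ a ↔
      a = optEffort κ δ γ (∫ ω, ω ^ (1 - γ) ∂μ) := by
  have hx := integral_rpow_mem_uIcc hlo hμ (1 - γ)
  have hx0 := pos_of_mem_uIcc_rpow hlo (hlo.trans_le hlohi) hx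
  have hopt := optEffort_mem_effortSet hκ₀ hκ₁ hδ hγ hγ₁ hlo hlohi hint hx
  have hlt : ∀ b ∈ effortSet γ aLo aHi, b ≠ optEffort κ δ γ (∫ ω, ω ^ (1 - γ) ∂μ) →
      ∫ ω, agentUtility κ δ γ ω b ∂μ <
        ∫ ω, agentUtility κ δ γ ω (optEffort κ δ γ (∫ ω, ω ^ (1 - γ) ∂μ)) ∂μ := by
    intro b hb hne
    rw [integral_agentUtility hδ hlo hμ (hA.trans hb.1.1),
      integral_agentUtility hδ hlo hμ (optEffort_pos hκ₀ hδ hx0).le]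
    exact mul_rpow_sub_lt_optEffort hκ₀ hκ₁ hδ hγ hγ₁ hx0 (hA.trans hb.1.1) hb.2 hne
  constructor
  · rintro ⟨ha, hmax⟩
    by_contra hne
    exact (hlt a ha hne).not_ge (hmax _ hopt)
  · rintro rfl
    refine ⟨hopt, fun b hb => ?_⟩
    by_cases hne : b = optEffort κ δ γ (∫ ω, ω ^ (1 - γ) ∂μ)
    · rw [hne]
    · exact (hlt b hb hne).le

/-! ### Posterior moments -/

section PosteriorMoment

variable {M : Type*} [MeasurableSpace M] {p : Measure ℝ} [IsProbabilityMeasure p]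
  {K : Kernel ℝ M} [IsMarkovKernel K] {lo hi : ℝ}

/-- The posterior expectation of `ω ^ g`. -/
noncomputable def posteriorMoment (K : Kernel ℝ M) [IsMarkovKernel K] (p : Measure ℝ)
    [IsFiniteMeasure p] (g : ℝ) (m : M) : ℝ :=
  ∫ ω, ω ^ g ∂(posterior K p m)

lemma measurable_posteriorMoment (g : ℝ) : Measurable (posteriorMoment K p g) :=
  (StronglyMeasurable.integral_kernel
    (measurable_id.pow_const g).stronglyMeasurable).measurable

/-- Posteriors average back to the prior, so a prior-null set is null under almost every posterior.
-/
lemma ae_posterior_mem (hp : ∀ᵐ ω ∂p, ω ∈ Set.Icc lo hi) :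
    ∀ᵐ m ∂(Measure.bind p K), ∀ᵐ ω ∂(posterior K p m), ω ∈ Set.Icc lo hi := by
  refine Measure.ae_ae_of_ae_comp ?_
  rwa [posterior_comp_self]

lemma ae_compProd_of_ae_bind {q : M → Prop} (h : ∀ᵐ m ∂(Measure.bind p K), q m) :
    ∀ᵐ z ∂(p.compProd K), q z.2 := by
  rw [← Measure.snd_compProd] at h
  exact ae_of_ae_map measurable_snd.aemeasurable h

lemma ae_compProd_of_ae_prior {q : ℝ → Prop} (h : ∀ᵐ ω ∂p, q ω) :
    ∀ᵐ z ∂(p.compProd K), q z.1 := by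
  rw [← Measure.fst_compProd p K] at h
  exact ae_of_ae_map measurable_fst.aemeasurable h

lemma ae_mem_prod (hlo : 0 < lo) (hp : ∀ᵐ ω ∂p, ω ∈ Set.Icc lo hi) (g : ℝ) :
    ∀ᵐ z ∂(p.compProd K),
      z.1 ∈ Set.Icc lo hi ∧ posteriorMoment K p g z.2 ∈ Set.uIcc (lo ^ g) (hi ^ g) :=
  (ae_compProd_of_ae_prior hp).and <| ae_compProd_of_ae_bind <|
    (ae_posterior_mem hp).mono fun _ hm => integral_rpow_mem_uIcc hlo hm g

lemma integrable_comp_posteriorMoment (hlo : 0 < lo) (hp : ∀ᵐ ω ∂p, ω ∈ Set.Icc lo hi) (g : ℝ)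
    {F : ℝ × ℝ → ℝ} (hFm : Measurable F)
    (hFc : ContinuousOn F (Set.Icc lo hi ×ˢ Set.uIcc (lo ^ g) (hi ^ g))) :
    Integrable (fun z : ℝ × M => F (z.1, posteriorMoment K p g z.2)) (p.compProd K) := by
  obtain ⟨C, hC⟩ := (isCompact_Icc.prod isCompact_uIcc).exists_bound_of_continuousOn hFc
  have hm := measurable_posteriorMoment (K := K) (p := p) g
  refine Integrable.of_bound (hFm.comp (by fun_prop)).aestronglyMeasurable C ?_
  filter_upwards [ae_mem_prod hlo hp g] with z hz using hC _ ⟨hz.1, hz.2⟩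

/-- Any function of the message is orthogonal to the deviation of `ω ^ g` from its posterior
expectation. -/
lemma integral_mul_sub_posteriorMoment (hlo : 0 < lo) (hp : ∀ᵐ ω ∂p, ω ∈ Set.Icc lo hi) (g : ℝ)
    {f : ℝ → ℝ} (hf : Measurable f)
    (hint : Integrable (fun z : ℝ × M => f (posteriorMoment K p g z.2) *
      (z.1 ^ g - posteriorMoment K p g z.2)) (p.compProd K)) :
    ∫ z : ℝ × M, f (posteriorMoment K p g z.2) * (z.1 ^ g - posteriorMoment K p g z.2)
      ∂(p.compProd K) = 0 := by
  have hm := measurable_posteriorMoment (K := K) (p := p) g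
  set F : M × ℝ → ℝ := fun z =>
    f (posteriorMoment K p g z.1) * (z.2 ^ g - posteriorMoment K p g z.1) with hF
  have hFm : Measurable F := by fun_prop
  -- The joint law is disintegrated with the message first, so that the inner integral is over the
  -- posterior and f is constant in it.
  have h1 : ∫ z : ℝ × M, F z.swap ∂(p.compProd K) =
      ∫ z, F z ∂((Measure.bind p K).compProd (posterior K p)) := by
    rw [compProd_posterior_eq_map_swap,
      integral_map measurable_swap.aemeasurable hFm.aestronglyMeasurable]
  have h2 : Integrable F ((Measure.bind p K).compProd (posterior K p)) := by
    rw [compProd_posterior_eq_map_swap]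
    exact (integrable_map_measure hFm.aestronglyMeasurable measurable_swap.aemeasurable).2 hint
  change ∫ z : ℝ × M, F z.swap ∂(p.compProd K) = 0
  rw [h1, Measure.integral_compProd h2]
  refine integral_eq_zero_of_ae ?_
  filter_upwards [ae_posterior_mem (K := K) hp] with m hμ
  simp only [hF, Pi.zero_apply]
  rw [integral_const_mul, integral_sub (integrable_rpow_of_ae_mem hlo hμ g) (integrable_const _)]
  simp [posteriorMoment]

lemma posteriorMoment_fullDisclosure (g : ℝ) :
    ∀ᵐ z ∂(p.compProd fullDisclosure), posteriorMoment fullDisclosure p g z.2 = z.1 ^ g := by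
  have hm := measurable_posteriorMoment (K := fullDisclosure) (p := p) g
  refine Measure.ae_compProd_of_ae_ae
    (measurableSet_eq_fun (by fun_prop) (by fun_prop)) ?_
  filter_upwards [posterior_id p] with ω hω
  rw [Kernel.id_apply, ae_dirac_iff (measurableSet_eq_fun (by fun_prop) (by fun_prop)),
    posteriorMoment, hω, Kernel.id_apply, integral_dirac]

end PosteriorMoment

end Persuasion

namespace Persuasion

/-! ### The principal's payoff -/

section Payoff

variable {κ δ γ ρ lo hi aLo aHi : ℝ} {M : Type*} [MeasurableSpace M] {p : Measure ℝ}
  [IsProbabilityMeasure p] {K : Kernel ℝ M} [IsMarkovKernel K]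

lemma measurable_optEffort : Measurable (optEffort κ δ γ) := by
  unfold optEffort
  fun_prop

lemma isOptimalPlan_iff (hκ₀ : 0 < κ) (hκ₁ : κ < 1) (hδ : 0 < δ) (hγ : 0 ≤ γ) (hγ₁ : γ ≠ 1)
    (hlo : 0 < lo) (hlohi : lo ≤ hi) (hA : 0 ≤ aLo)
    (hint : ∀ ω ∈ Set.Icc lo hi, ∃ a ∈ Set.Icc aLo aHi,
      0 < a ∧ HasDerivAt (agentUtility κ δ γ ω) 0 a)
    (hp : ∀ᵐ ω ∂p, ω ∈ Set.Icc lo hi) (σ : M → ℝ) :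
    IsOptimalPlan (effortSet γ aLo aHi) (agentUtility κ δ γ) p K σ ↔
      Measurable σ ∧
        ∀ᵐ m ∂(Measure.bind p K), σ m = optEffort κ δ γ (posteriorMoment K p (1 - γ) m) := by
  have h : ∀ᵐ m ∂(Measure.bind p K),
      (IsBestResponse (effortSet γ aLo aHi) (agentUtility κ δ γ) (posterior K p m) (σ m) ↔
        σ m = optEffort κ δ γ (posteriorMoment K p (1 - γ) m)) := by
    filter_upwards [ae_posterior_mem (K := K) hp] with m hm
    exact isBestResponse_iff hκ₀ hκ₁ hδ hγ hγ₁ hlo hlohi hA hint hm _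
  exact ⟨fun hσ => ⟨hσ.measurable, by filter_upwards [h, hσ.optimal] with m h1 h2 using h1.1 h2⟩,
    fun hσ => ⟨hσ.1, by filter_upwards [h, hσ.2] with m h1 h2 using h1.2 h2⟩⟩

lemma continuousOn_rpow_fst {s : Set (ℝ × ℝ)} (hs : ∀ z ∈ s, 0 < z.1) (g : ℝ) :
    ContinuousOn (fun z : ℝ × ℝ => z.1 ^ g) s :=
  continuousOn_fst.rpow_const fun z hz => Or.inl (hs z hz).ne'

lemma continuousOn_rpow_snd {s : Set (ℝ × ℝ)} (hs : ∀ z ∈ s, 0 < z.2) (g : ℝ) :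
    ContinuousOn (fun z : ℝ × ℝ => z.2 ^ g) s :=
  continuousOn_snd.rpow_const fun z hz => Or.inl (hs z hz).ne'

lemma pos_of_mem_Icc_prod_uIcc (hlo : 0 < lo) (hlohi : lo ≤ hi) {g : ℝ} {z : ℝ × ℝ}
    (hz : z ∈ Set.Icc lo hi ×ˢ Set.uIcc (lo ^ g) (hi ^ g)) : 0 < z.1 ∧ 0 < z.2 :=
  ⟨hlo.trans_le hz.1.1, pos_of_mem_uIcc_rpow hlo (hlo.trans_le hlohi) hz.2⟩

lemma integrable_principalUtility (hκ₀ : 0 < κ) (hδ₀ : 0 < δ) (hδ₁ : δ < 1)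
    (hγ₁ : γ ≠ 1) (hlo : 0 < lo) (hlohi : lo ≤ hi) (hp : ∀ᵐ ω ∂p, ω ∈ Set.Icc lo hi) :
    Integrable (fun z : ℝ × M => principalUtility κ δ ρ z.1
      (optEffort κ δ γ (posteriorMoment K p (1 - γ) z.2))) (p.compProd K) := by
  refine integrable_comp_posteriorMoment hlo hp (1 - γ)
    (F := fun z => principalUtility κ δ ρ z.1 (optEffort κ δ γ z.2)) ?_ ?_
  · unfold principalUtility crra output wage optEffort
    fun_prop
  · have h1 := continuousOn_rpow_fst (fun z hz =>
      (pos_of_mem_Icc_prod_uIcc (g := 1 - γ) (z := z) hlo hlohi hz).1) (1 - γ)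
    have h2 := continuousOn_rpow_snd (fun z hz =>
      (pos_of_mem_Icc_prod_uIcc (g := 1 - γ) (z := z) hlo hlohi hz).2) (effortExponent κ γ ρ)
    have h3 := h1.rpow_const (p := (1 - ρ) / (1 - γ)) fun z hz => Or.inl
      (Real.rpow_pos_of_pos (pos_of_mem_Icc_prod_uIcc hlo hlohi hz).1 _).ne'
    refine ((continuousOn_const (c := payoffScale κ δ γ ρ / (1 - ρ))).mul (h3.mul h2)).congr fun z hz => ?_
    have hz' := pos_of_mem_Icc_prod_uIcc hlo hlohi hz
    exact principalUtility_optEffort hκ₀ hδ₀ hδ₁ hγ₁ hz'.1 hz'.2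

lemma integrable_mul_powerGap (c t s g : ℝ) (hlo : 0 < lo) (hlohi : lo ≤ hi)
    (hp : ∀ᵐ ω ∂p, ω ∈ Set.Icc lo hi) :
    Integrable (fun z : ℝ × M => c * powerGap t s (z.1 ^ g) (posteriorMoment K p g z.2))
      (p.compProd K) := by
  refine integrable_comp_posteriorMoment hlo hp g
    (F := fun z => c * powerGap t s (z.1 ^ g) z.2) ?_ ?_
  · unfold powerGap
    fun_prop
  · have hpos := fun z hz => pos_of_mem_Icc_prod_uIcc (g := g) (z := z) hlo hlohi hz
    have h1 := continuousOn_rpow_fst (fun z hz => (hpos z hz).1) g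
    have h2 := fun q => continuousOn_rpow_snd (fun z hz => (hpos z hz).2) q
    have h3 := fun q => h1.rpow_const (p := q) fun z hz => Or.inl
      (Real.rpow_pos_of_pos (hpos z hz).1 _).ne'
    exact continuousOn_const.mul (((h3 _).sub ((h3 _).mul (h2 _))).sub
      ((continuousOn_const.mul (h2 _)).mul (h1.sub continuousOn_snd)))

lemma integrable_mul_sub_posteriorMoment (c q g : ℝ) (hlo : 0 < lo) (hlohi : lo ≤ hi)
    (hp : ∀ᵐ ω ∂p, ω ∈ Set.Icc lo hi) :
    Integrable (fun z : ℝ × M => c * posteriorMoment K p g z.2 ^ q *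
      (z.1 ^ g - posteriorMoment K p g z.2)) (p.compProd K) := by
  refine integrable_comp_posteriorMoment hlo hp g
    (F := fun z => c * z.2 ^ q * (z.1 ^ g - z.2)) (by fun_prop) ?_
  have hpos := fun z hz => pos_of_mem_Icc_prod_uIcc (g := g) (z := z) hlo hlohi hz
  have h1 := continuousOn_rpow_fst (fun z hz => (hpos z hz).1) g
  have h2 := continuousOn_rpow_snd (fun z hz => (hpos z hz).2) q
  exact (continuousOn_const.mul h2).mul (h1.sub continuousOn_snd)

/-- The principal's payoff exists and is the expected utility from the optimal efforts. -/
lemma isSenderPayoff_iff (hκ₀ : 0 < κ) (hκ₁ : κ < 1) (hδ₀ : 0 < δ) (hδ₁ : δ < 1) (hγ : 0 ≤ γ)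
    (hγ₁ : γ ≠ 1) (hlo : 0 < lo) (hlohi : lo ≤ hi) (hA : 0 ≤ aLo)
    (hint : ∀ ω ∈ Set.Icc lo hi, ∃ a ∈ Set.Icc aLo aHi,
      0 < a ∧ HasDerivAt (agentUtility κ δ γ ω) 0 a)
    (hp : ∀ᵐ ω ∂p, ω ∈ Set.Icc lo hi) (v : ℝ) :
    IsSenderPayoff (effortSet γ aLo aHi) (agentUtility κ δ γ) (principalUtility κ δ ρ) p K v ↔
      v = ∫ z : ℝ × M, principalUtility κ δ ρ z.1
        (optEffort κ δ γ (posteriorMoment K p (1 - γ) z.2)) ∂(p.compProd K) := by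
  constructor
  · rintro ⟨σ, hσ, -, rfl⟩
    rw [isOptimalPlan_iff hκ₀ hκ₁ hδ₀ hγ hγ₁ hlo hlohi hA hint hp] at hσ
    refine integral_congr_ae ?_
    filter_upwards [ae_compProd_of_ae_bind hσ.2] with z hz
    rw [hz]
  · rintro rfl
    refine ⟨fun m => optEffort κ δ γ (posteriorMoment K p (1 - γ) m),
      (isOptimalPlan_iff hκ₀ hκ₁ hδ₀ hγ hγ₁ hlo hlohi hA hint hp _).2
        ⟨measurable_optEffort.comp (measurable_posteriorMoment _), ae_of_all _ fun _ => rfl⟩,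
      integrable_principalUtility hκ₀ hδ₀ hδ₁ hγ₁ hlo hlohi hp, rfl⟩

/-- The principal's advantage of full disclosure over the information structure `K`. -/
lemma integral_fullDisclosure_sub (hκ₀ : 0 < κ) (hδ₀ : 0 < δ) (hδ₁ : δ < 1) (hγ₁ : γ ≠ 1)
    (hlo : 0 < lo) (hlohi : lo ≤ hi) (hp : ∀ᵐ ω ∂p, ω ∈ Set.Icc lo hi) :
    (∫ z : ℝ × ℝ, principalUtility κ δ ρ z.1
        (optEffort κ δ γ (posteriorMoment fullDisclosure p (1 - γ) z.2))
          ∂(p.compProd fullDisclosure)) -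
      (∫ z : ℝ × M, principalUtility κ δ ρ z.1
        (optEffort κ δ γ (posteriorMoment K p (1 - γ) z.2)) ∂(p.compProd K)) =
    ∫ z : ℝ × M, payoffScale κ δ γ ρ / (1 - ρ) *
      powerGap ((1 - ρ) / (1 - γ)) (effortExponent κ γ ρ) (z.1 ^ (1 - γ))
        (posteriorMoment K p (1 - γ) z.2) ∂(p.compProd K) := by
  set t := (1 - ρ) / (1 - γ)
  set s := effortExponent κ γ ρ
  set c := payoffScale κ δ γ ρ / (1 - ρ)
  have hVm : Measurable fun ω => principalUtility κ δ ρ ω (optEffort κ δ γ (ω ^ (1 - γ))) := by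
    unfold principalUtility crra output wage optEffort
    fun_prop
  have hfull : (∫ z : ℝ × ℝ, principalUtility κ δ ρ z.1
        (optEffort κ δ γ (posteriorMoment fullDisclosure p (1 - γ) z.2))
          ∂(p.compProd fullDisclosure)) =
      ∫ ω, principalUtility κ δ ρ ω (optEffort κ δ γ (ω ^ (1 - γ))) ∂p := by
    conv_rhs => rw [← Measure.fst_compProd p fullDisclosure, Measure.fst,
      integral_map measurable_fst.aemeasurable hVm.aestronglyMeasurable]
    refine integral_congr_ae ?_
    filter_upwards [posteriorMoment_fullDisclosure (p := p) (1 - γ)] with z hz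
    rw [hz]
  -- The full-disclosure payoff depends on the state alone, so it can be integrated against the
  -- joint law of K and compared pointwise.
  have hprior : ∫ ω, principalUtility κ δ ρ ω (optEffort κ δ γ (ω ^ (1 - γ))) ∂p =
      ∫ z : ℝ × M, principalUtility κ δ ρ z.1 (optEffort κ δ γ (z.1 ^ (1 - γ)))
        ∂(p.compProd K) := by
    conv_lhs => rw [← Measure.fst_compProd p K, Measure.fst,
      integral_map measurable_fst.aemeasurable hVm.aestronglyMeasurable]
  have hV := integrable_principalUtility (ρ := ρ) (K := K) hκ₀ hδ₀ hδ₁ hγ₁ hlo hlohi hp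
  have hG := integrable_mul_powerGap (K := K) c t s (1 - γ) hlo hlohi hp
  have hL := integrable_mul_sub_posteriorMoment (K := K) (c * s) (t + s - 1) (1 - γ) hlo hlohi hp
  have hzero := integral_mul_sub_posteriorMoment (f := fun x => c * s * x ^ (t + s - 1)) hlo hp
    (1 - γ) (by fun_prop) hL
  have hae : ∀ᵐ z ∂(p.compProd K),
      principalUtility κ δ ρ z.1 (optEffort κ δ γ (z.1 ^ (1 - γ))) =
        principalUtility κ δ ρ z.1 (optEffort κ δ γ (posteriorMoment K p (1 - γ) z.2)) +
        (c * powerGap t s (z.1 ^ (1 - γ)) (posteriorMoment K p (1 - γ) z.2) +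
        c * s * posteriorMoment K p (1 - γ) z.2 ^ (t + s - 1) *
          (z.1 ^ (1 - γ) - posteriorMoment K p (1 - γ) z.2)) := by
    filter_upwards [ae_mem_prod hlo hp (1 - γ)] with z hz
    have := principalUtility_sub_eq (ρ := ρ) hκ₀ hδ₀ hδ₁ hγ₁ (hlo.trans_le hz.1.1)
      (pos_of_mem_uIcc_rpow hlo (hlo.trans_le hlohi) hz.2)
    rw [← mul_assoc] at this
    linarith
  rw [hfull, hprior, integral_congr_ae hae, integral_add hV, integral_add hG hL, hzero]
  · ring
  · exact hG.add hL

end Payoff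

/-- A probability measure with two points in its support is not concentrated on one point. -/
lemma not_ae_eq_const_of_mem_support {p : Measure ℝ} {ω₁ ω₂ : ℝ} (h₁ : ω₁ ∈ p.support)
    (h₂ : ω₂ ∈ p.support) (hne : ω₁ ≠ ω₂) (c : ℝ) : ¬ ∀ᵐ ω ∂p, ω = c := by
  have key : ∀ ω ∈ p.support, (∀ᵐ ω ∂p, ω = c) → ω = c := by
    intro ω hω hc
    by_contra hωc
    exact ((Measure.mem_support_iff_forall ω).1 hω {c}ᶜ
      (isOpen_compl_singleton.mem_nhds hωc)).ne' hc
  exact fun hc => hne ((key _ h₁ hc).trans (key _ h₂ hc).symm)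

end Persuasion

/-! ### Optimality and suboptimality of full disclosure -/

open Persuasion in
theorem mainTheorem5 (κ δ γ ρ : ℝ) (hκ₀ : 0 < κ) (hκ₁ : κ < 1) (hδ₀ : 0 < δ) (hδ₁ : δ < 1)
    (hγ₀ : 0 ≤ γ) (hγ₁ : γ ≠ 1) (hρ₀ : 0 ≤ ρ) (hρ₁ : ρ ≠ 1)
    (ωLo ωHi : ℝ) (hΩ : 0 < ωLo) (hΩ' : ωLo ≤ ωHi)
    (aLo aHi : ℝ) (hA : 0 ≤ aLo) (hA' : aLo ≤ aHi)
    (hint : ∀ ω ∈ Set.Icc ωLo ωHi, ∃ a ∈ Set.Icc aLo aHi,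
      0 < a ∧ HasDerivAt (Persuasion.agentUtility κ δ γ ω) 0 a)
    (p : MeasureTheory.Measure ℝ) [MeasureTheory.IsProbabilityMeasure p]
    (hp : ∀ᵐ ω ∂p, ω ∈ Set.Icc ωLo ωHi) :
    Persuasion.IsWellPosed.{u} (Persuasion.effortSet γ aLo aHi)
        (Persuasion.agentUtility κ δ γ) (Persuasion.principalUtility κ δ ρ) p ∧
      ((ρ ≤ γ ∧ γ < 1) ∨ (γ ≤ ρ ∧ 1 < γ) →
        Persuasion.FullDisclosureOptimal.{u} (Persuasion.effortSet γ aLo aHi)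
          (Persuasion.agentUtility κ δ γ) (Persuasion.principalUtility κ δ ρ) p) ∧
      ((ρ < 1 ∧ 1 < γ) ∨ (γ < 1 ∧ 1 < ρ) →
        (∃ ω₁ ∈ p.support, ∃ ω₂ ∈ p.support, ω₁ ≠ ω₂) →
        Persuasion.FullDisclosureSuboptimal.{u} (Persuasion.effortSet γ aLo aHi)
          (Persuasion.agentUtility κ δ γ) (Persuasion.principalUtility κ δ ρ) p) := by
  refine ⟨?_, ?_, ?_⟩
  · intro M _ K _
    exact ⟨_, (isSenderPayoff_iff hκ₀ hκ₁ hδ₀ hδ₁ hγ₀ hγ₁ hΩ hΩ' hA hint hp _).2 rfl,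
      fun v hv => (isSenderPayoff_iff hκ₀ hκ₁ hδ₀ hδ₁ hγ₀ hγ₁ hΩ hΩ' hA hint hp v).1 hv⟩
  · intro hcase
    refine ⟨_, (isSenderPayoff_iff hκ₀ hκ₁ hδ₀ hδ₁ hγ₀ hγ₁ hΩ hΩ' hA hint hp _).2 rfl, ?_⟩
    intro M _ K _ v hv
    rw [isSenderPayoff_iff hκ₀ hκ₁ hδ₀ hδ₁ hγ₀ hγ₁ hΩ hΩ' hA hint hp] at hv
    rw [hv, ← sub_nonneg, integral_fullDisclosure_sub hκ₀ hδ₀ hδ₁ hγ₁ hΩ hΩ' hp]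
    refine integral_nonneg_of_ae ?_
    filter_upwards [ae_mem_prod hΩ hp (1 - γ)] with z hz
    exact mul_powerGap_nonneg hκ₀ hκ₁ hδ₀ hδ₁ hγ₀ hcase
      (Real.rpow_pos_of_pos (hΩ.trans_le hz.1.1) _)
      (pos_of_mem_uIcc_rpow hΩ (hΩ.trans_le hΩ') hz.2)
  · rintro hcase ⟨ω₁, h₁, ω₂, h₂, hne⟩
    refine ⟨_, (isSenderPayoff_iff hκ₀ hκ₁ hδ₀ hδ₁ hγ₀ hγ₁ hΩ hΩ' hA hint hp _).2 rfl,
      -- The better structure is no disclosure: a single uninformative message.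
      PUnit.{u + 1}, inferInstance, Kernel.const ℝ (Measure.dirac PUnit.unit), inferInstance, _,
      (isSenderPayoff_iff hκ₀ hκ₁ hδ₀ hδ₁ hγ₀ hγ₁ hΩ hΩ' hA hint hp _).2 rfl, ?_⟩
    set K : Kernel ℝ PUnit.{u + 1} := Kernel.const ℝ (Measure.dirac PUnit.unit)
    rw [← sub_neg, integral_fullDisclosure_sub hκ₀ hδ₀ hδ₁ hγ₁ hΩ hΩ' hp]
    have hae := ae_mem_prod (K := K) hΩ hp (1 - γ)
    have hG := integrable_mul_powerGap (K := K) (payoffScale κ δ γ ρ / (1 - ρ))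
      ((1 - ρ) / (1 - γ)) (effortExponent κ γ ρ) (1 - γ) hΩ hΩ' hp
    have hneg : ∀ᵐ z ∂(p.compProd K), z.1 ^ (1 - γ) ≠ posteriorMoment K p (1 - γ) z.2 →
        payoffScale κ δ γ ρ / (1 - ρ) * powerGap ((1 - ρ) / (1 - γ)) (effortExponent κ γ ρ)
          (z.1 ^ (1 - γ)) (posteriorMoment K p (1 - γ) z.2) < 0 := by
      filter_upwards [hae] with z hz
      exact mul_powerGap_neg hκ₀ hκ₁ hδ₀ hδ₁ hγ₀ hcase
        (Real.rpow_pos_of_pos (hΩ.trans_le hz.1.1) _)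
        (pos_of_mem_uIcc_rpow hΩ (hΩ.trans_le hΩ') hz.2)
    have hle : ∀ᵐ z ∂(p.compProd K), payoffScale κ δ γ ρ / (1 - ρ) *
        powerGap ((1 - ρ) / (1 - γ)) (effortExponent κ γ ρ)
          (z.1 ^ (1 - γ)) (posteriorMoment K p (1 - γ) z.2) ≤ 0 := by
      filter_upwards [hae, hneg] with z hz hn
      by_cases h : z.1 ^ (1 - γ) = posteriorMoment K p (1 - γ) z.2
      · rw [h, powerGap_self (pos_of_mem_uIcc_rpow hΩ (hΩ.trans_le hΩ') hz.2), mul_zero]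
      · exact (hn h).le
    refine lt_of_le_of_ne (integral_nonpos_of_ae hle) fun h0 => ?_
    -- A nonpositive integrand with zero integral vanishes almost everywhere, which forces ω ^ (1 -
    -- γ) to equal its prior mean and so pins down a single state.
    have hz0 := (integral_eq_zero_iff_of_nonneg_ae (hle.mono fun z hz => neg_nonneg.2 hz)
      hG.neg).1 ((integral_neg _).trans (neg_eq_zero.2 h0))
    refine not_ae_eq_const_of_mem_support h₁ h₂ hne
      (posteriorMoment K p (1 - γ) PUnit.unit ^ (1 - γ)⁻¹) ?_
    have hjoint : ∀ᵐ z ∂(p.compProd K),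
        z.1 = posteriorMoment K p (1 - γ) PUnit.unit ^ (1 - γ)⁻¹ := by
      filter_upwards [hae, hneg, hz0] with z hz hn hz0
      have heq : z.1 ^ (1 - γ) = posteriorMoment K p (1 - γ) PUnit.unit := by
        by_contra h
        exact (hn h).ne (neg_eq_zero.1 hz0)
      rw [← heq, Real.rpow_rpow_inv (hΩ.trans_le hz.1.1).le (sub_ne_zero.2 hγ₁.symm)]
    generalize posteriorMoment K p (1 - γ) PUnit.unit ^ (1 - γ)⁻¹ = c at hjoint ⊢
    rw [← Measure.fst_compProd p K, Measure.fst]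
    exact (ae_map_iff measurable_fst.aemeasurable (measurableSet_singleton c)).2 hjoint
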